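/- Let $\mathbb D=\{z\in\mathbb C:|z|<1\}$ and let $\mathcal S^*_{\mathcal B}$ be the class of functions $f$ analytic on $\mathbb D$, with expansion $f(z)=z+\sum_{n\ge 2}a_nz^n$ and $f(z)\neq 0$ for $0<|z|<1$, for which there is an analytic function $w:\mathbb D\to\mathbb C$ with $w(0)=0$ and $|w(z)|\le|z|$ such that $$\frac{zf'(z)}{f(z)}=\sqrt{1+\tanh w(z)}\qquad(z\in\mathbb D),$$ where the square root is the principal branch and the left-hand side is given its limiting value $1$ at $z=0$. For $f\in\mathcal S^*_{\mathcal B}$, put $a_1=1$ and let $$H_4(1)=\det\begin{pmatrix}a_1&a_2&a_3&a_4\\a_2&a_3&a_4&a_5\\a_3&a_4&a_5&a_6\\a_4&a_5&a_6&a_7\end{pmatrix}$$ be its fourth-order Hankel determinant. **Theorem.** If $f\in\mathcal S^*_{\mathcal B}$, then $|H_4(1)|\le 0.169251$. -/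

import Mathlib

open Metric

noncomputable section

/-- The class `𝒜`: functions analytic on the open unit disk with `f 0 = 0` and `f' 0 = 1`, i.e.
`f z = z + a₂ z² + a₃ z³ + ⋯`. (Values outside the disk are irrelevant.) -/
def ClassA : Set (ℂ → ℂ) :=
  {f | DifferentiableOn ℂ f (ball 0 1) ∧ f 0 = 0 ∧ deriv f 0 = 1}

/-- Schwarz functions: analytic on the open unit disk, `w 0 = 0` and `|w z| ≤ |z|`. -/
def IsSchwarzFunction (w : ℂ → ℂ) : Prop :=
  DifferentiableOn ℂ w (ball 0 1) ∧ w 0 = 0 ∧ ∀ z ∈ ball (0 : ℂ) 1, ‖w z‖ ≤ ‖z‖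

/-- Subordination `h ≺ g` on the open unit disk: `h = g ∘ w` for some Schwarz function `w`. -/
def Subordinate (h g : ℂ → ℂ) : Prop :=
  ∃ w : ℂ → ℂ, IsSchwarzFunction w ∧ ∀ z ∈ ball (0 : ℂ) 1, h z = g (w z)

/-- The quotient `z f'(z) / f(z)`, with its removable singularity at the origin filled by the
limit `1` (the limit for every `f` in `ClassA`). -/
def starlikeQuotient (f : ℂ → ℂ) : ℂ → ℂ :=
  Function.update (fun z => z * deriv f z / f z) 0 1

/-- The function `√(1 + tanh z)` (principal branch), mapping the disk to a bean-shaped domain. -/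
def beanFunction (z : ℂ) : ℂ := Complex.sqrt (1 + Complex.tanh z)

/-- The class `𝒮*_ℬ`: those `f` in `𝒜` for which `z f'(z) / f(z)` is defined on the disk
(`f` has no zero besides the origin) and is subordinate to `√(1 + tanh z)`. -/
def StarlikeBean : Set (ℂ → ℂ) :=
  {f | f ∈ ClassA ∧ (∀ z ∈ ball (0 : ℂ) 1, z ≠ 0 → f z ≠ 0) ∧
    Subordinate (starlikeQuotient f) beanFunction}

/-- The Taylor coefficient `aₙ` of `f` at the origin. -/
def taylorCoeff (f : ℂ → ℂ) (n : ℕ) : ℂ := iteratedDeriv n f 0 / (n.factorial : ℂ)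

/-- The Hankel determinant `H_q(n)`: the determinant of the `q × q` matrix whose entry in row `i`
and column `j` (counted from `0`) is `a_{n+i+j}`. -/
def hankelDet (f : ℂ → ℂ) (q n : ℕ) : ℂ :=
  (Matrix.of fun i j : Fin q => taylorCoeff f (n + (i : ℕ) + (j : ℕ))).det

end

/-! Write `z f' = f p` with `p = B ∘ w` and `B = √(1 + tanh)`. Composition with a Schwarz function
does not increase the ℓ²-norm of an initial segment of coefficients
(`sum_normSq_taylorCoeff_comp_le`), so `|p₁|² + ⋯ + |p₆|²` is at most the same sum for `B`, about
0.28, hence below 3/10.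

Comparing coefficients gives `(n - 1) aₙ = ∑_{k<n} aₖ p_{n-k}`, and Cauchy–Schwarz turns this into
`(n - 1)² |aₙ|² ≤ (3/10) ∑_{k<n} |aₖ|²` (`normSq_taylorCoeff_le`). Recursively this bounds `a₂, …,
a₇`. The permanent of the matrix of these bounds is about 0.102, so crude estimates of the
determinant suffice. -/

/-- The Taylor series at the origin, as a formal power series. -/
noncomputable def taylorSeries (f : ℂ → ℂ) : PowerSeries ℂ := PowerSeries.mk (taylorCoeff f)

/-! ### Taylor coefficients at the origin as formal power series. -/

section TaylorSeries

open Filter Topology PowerSeries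

@[simp] lemma coeff_taylorSeries (f : ℂ → ℂ) (n : ℕ) :
    coeff n (taylorSeries f) = taylorCoeff f n := by
  simp [taylorSeries]

lemma taylorCoeff_zero (f : ℂ → ℂ) : taylorCoeff f 0 = f 0 := by
  simp [taylorCoeff]

lemma taylorCoeff_one (f : ℂ → ℂ) : taylorCoeff f 1 = deriv f 0 := by
  simp [taylorCoeff]

lemma taylorSeries_congr {f g : ℂ → ℂ} (h : f =ᶠ[𝓝 0] g) : taylorSeries f = taylorSeries g := by
  ext n
  simp [taylorCoeff, h.iteratedDeriv_eq n]

lemma taylorSeries_add {f g : ℂ → ℂ} (hf : AnalyticAt ℂ f 0) (hg : AnalyticAt ℂ g 0) :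
    taylorSeries (fun z => f z + g z) = taylorSeries f + taylorSeries g := by
  ext n
  have := iteratedDeriv_add (n := n) hf.contDiffAt hg.contDiffAt
  simp only [coeff_taylorSeries, taylorCoeff, map_add, ← add_div]
  rw [← this]
  rfl

lemma taylorSeries_mul {f g : ℂ → ℂ} (hf : AnalyticAt ℂ f 0) (hg : AnalyticAt ℂ g 0) :
    taylorSeries (fun z => f z * g z) = taylorSeries f * taylorSeries g := by
  ext n
  simp only [coeff_taylorSeries, taylorCoeff, coeff_mul,
    iteratedDeriv_fun_mul hf.contDiffAt hg.contDiffAt,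
    Finset.Nat.sum_antidiagonal_eq_sum_range_succ_mk, Finset.sum_div]
  refine Finset.sum_congr rfl fun i hi => ?_
  rw [Nat.cast_choose _ (by grind)]
  field_simp [Nat.factorial_ne_zero]

lemma taylorSeries_const (c : ℂ) : taylorSeries (fun _ => c) = C c := by
  ext n
  simp only [coeff_taylorSeries, taylorCoeff, iteratedDeriv_const, coeff_C]
  split_ifs with h <;> simp [h]

lemma taylorSeries_id : taylorSeries (fun z => z) = X := by
  ext n
  simp only [coeff_taylorSeries, taylorCoeff, iteratedDeriv_fun_id_zero, coeff_X]
  split_ifs with h <;> simp [h]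

lemma taylorSeries_deriv (f : ℂ → ℂ) :
    taylorSeries (deriv f) = d⁄dX ℂ (taylorSeries f) := by
  ext n
  rw [coeff_derivative]
  simp only [coeff_taylorSeries, taylorCoeff, ← iteratedDeriv_succ', Nat.factorial_succ]
  have : (n : ℂ) + 1 ≠ 0 := by exact_mod_cast n.succ_ne_zero
  push_cast
  field_simp [Nat.factorial_ne_zero]

lemma taylorSeries_pow {f : ℂ → ℂ} (hf : AnalyticAt ℂ f 0) (n : ℕ) :
    taylorSeries (fun z => f z ^ n) = taylorSeries f ^ n := by
  induction n with
  | zero => simpa using taylorSeries_const 1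
  | succ n ih =>
    simp only [pow_succ]
    rw [taylorSeries_mul (hf.fun_pow n) hf, ih]

lemma analyticAt_dslope {f : ℂ → ℂ} (hf : AnalyticAt ℂ f 0) : AnalyticAt ℂ (dslope f 0) 0 := by
  obtain ⟨s, hs, hd⟩ := hf.exists_mem_nhds_analyticOnNhd
  exact ((Complex.differentiableOn_dslope hs).2 hd.differentiableOn).analyticAt hs

lemma eq_add_mul_dslope (f : ℂ → ℂ) (z : ℂ) : f z = f 0 + z * dslope f 0 z := by
  have := sub_smul_dslope f 0 z
  simp only [sub_zero, smul_eq_mul] at this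
  rw [this]; ring

lemma taylorCoeff_dslope {f : ℂ → ℂ} (hf : AnalyticAt ℂ f 0) (n : ℕ) :
    taylorCoeff (dslope f 0) n = taylorCoeff f (n + 1) := by
  have hd := analyticAt_dslope hf
  have hx : AnalyticAt ℂ (fun z => z * dslope f 0 z) 0 := analyticAt_id.fun_mul hd
  have h : taylorSeries f = C (f 0) + X * taylorSeries (dslope f 0) := by
    rw [← taylorSeries_const, ← taylorSeries_id, ← taylorSeries_mul (f := fun z => z) analyticAt_id hd,
      ← taylorSeries_add analyticAt_const hx]
    exact congrArg taylorSeries (funext (eq_add_mul_dslope f))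
  have := congrArg (coeff (n + 1)) h
  simpa [coeff_succ_X_mul, coeff_C] using this.symm

/-- Iterated `dslope`. The identity holds for every `z`, so `w z` can be substituted for `z`. -/
lemma exists_taylor_remainder (n : ℕ) : ∀ {h : ℂ → ℂ}, AnalyticAt ℂ h 0 →
    ∃ g : ℂ → ℂ, AnalyticAt ℂ g 0 ∧
      ∀ z, h z = ∑ k ∈ Finset.range n, taylorCoeff h k * z ^ k + z ^ n * g z := by
  induction n with
  | zero => exact fun {h} hh => ⟨h, hh, by simp⟩
  | succ n ih =>
    intro h hh
    obtain ⟨g, hg, hgz⟩ := ih (analyticAt_dslope hh)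
    refine ⟨g, hg, fun z => ?_⟩
    rw [eq_add_mul_dslope h z, hgz z, Finset.sum_range_succ', taylorCoeff_zero, mul_add,
      Finset.mul_sum]
    simp only [taylorCoeff_dslope hh, pow_succ]
    have : ∀ k, z * (taylorCoeff h (k + 1) * z ^ k) = taylorCoeff h (k + 1) * (z ^ k * z) :=
      fun k => by ring
    simp only [this]
    ring

end TaylorSeries

/-! ### Mean squares on circles and Rogosinski's inequality. -/

section Littlewood

open Real Filter Topology

/-- The cross term `2 Re(c̄ G)` has mean `2 Re(c̄ G(0)) = 0` by the mean value property. -/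
lemma circleAverage_normSq_const_add {G : ℂ → ℂ} (hG : DifferentiableOn ℂ G (ball 0 1))
    (h0 : G 0 = 0) (c : ℂ) {r : ℝ} (hr0 : 0 < r) (hr1 : r < 1) :
    circleAverage (fun z => ‖c + G z‖ ^ 2) 0 r =
      ‖c‖ ^ 2 + circleAverage (fun z => ‖G z‖ ^ 2) 0 r := by
  have hsub : sphere (0 : ℂ) r ⊆ ball 0 1 := fun z hz => by
    simp only [mem_sphere_zero_iff_norm] at hz; simpa [hz] using hr1
  have hc : ContinuousOn G (sphere 0 r) := hG.continuousOn.mono hsub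
  have hr : |r| = r := abs_of_pos hr0
  let L : ℂ →L[ℝ] ℝ := Complex.reCLM.comp ((ContinuousLinearMap.mul ℝ ℂ) (2 * starRingEnd ℂ c))
  have hL : ∀ z, L z = (2 * starRingEnd ℂ c * z).re := fun z => rfl
  have hLG : circleAverage (fun z => L (G z)) 0 r = 0 := by
    have h1 : DiffContOnCl ℂ G (ball 0 |r|) := by
      rw [hr]
      refine DifferentiableOn.diffContOnCl (hG.mono ?_)
      rw [closure_ball _ hr0.ne']
      exact closedBall_subset_ball hr1
    have h2 := h1.circleAverage
    have h3 := L.circleAverage_comp_comm (f := G) (c := 0) (R := r)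
      (ContinuousOn.circleIntegrable hr0.le hc)
    rw [h2, h0, map_zero] at h3
    exact h3
  have hfun : (fun z => ‖c + G z‖ ^ 2) = fun z => (‖c‖ ^ 2 + L (G z)) + ‖G z‖ ^ 2 := by
    funext z
    rw [hL]
    simp only [← Complex.normSq_eq_norm_sq, Complex.normSq_apply, Complex.add_re, Complex.add_im,
      Complex.mul_re, Complex.mul_im, Complex.conj_re, Complex.conj_im, Complex.re_ofNat,
      Complex.im_ofNat]
    ring
  have i1 : CircleIntegrable (fun z => L (G z)) 0 r :=
    ContinuousOn.circleIntegrable hr0.le (L.continuous.comp_continuousOn hc)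
  have i2 : CircleIntegrable (fun z => ‖G z‖ ^ 2) 0 r :=
    ContinuousOn.circleIntegrable hr0.le (hc.norm.pow 2)
  have i0 : CircleIntegrable (fun _ : ℂ => ‖c‖ ^ 2) 0 r :=
    ContinuousOn.circleIntegrable hr0.le continuousOn_const
  have i01 : CircleIntegrable (fun z => ‖c‖ ^ 2 + L (G z)) 0 r := i0.add i1
  rw [hfun, circleAverage_fun_add i01 i2, circleAverage_fun_add i0 i1, hLG,
    circleAverage_const, add_zero]

/-- A truncated Bessel inequality: splitting `F = F(0) + z · dslope F 0` peels off one coefficient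
at a time. -/
lemma sum_normSq_taylorCoeff_le_circleAverage {r : ℝ} (hr0 : 0 < r) (hr1 : r < 1) (n : ℕ) :
    ∀ {F : ℂ → ℂ}, DifferentiableOn ℂ F (ball 0 1) →
      ∑ k ∈ Finset.range n, ‖taylorCoeff F k‖ ^ 2 * r ^ (2 * k) ≤
        circleAverage (fun z => ‖F z‖ ^ 2) 0 r := by
  have hb : ball (0 : ℂ) 1 ∈ 𝓝 0 := ball_mem_nhds _ one_pos
  induction n with
  | zero =>
    intro F _
    simpa using circleAverage_nonneg_of_nonneg (fun z _ => by positivity)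
  | succ n ih =>
    intro F hF
    have hD := (Complex.differentiableOn_dslope hb).2 hF
    have h1 := circleAverage_normSq_const_add (G := fun z => z * dslope F 0 z)
      (differentiableOn_id.fun_mul hD) (by simp) (F 0) hr0 hr1
    simp only [← eq_add_mul_dslope F] at h1
    have h2 : circleAverage (fun z => ‖z * dslope F 0 z‖ ^ 2) 0 r =
        r ^ 2 * circleAverage (fun z => ‖dslope F 0 z‖ ^ 2) 0 r := by
      rw [← smul_eq_mul, ← circleAverage_fun_smul]
      refine circleAverage_congr_sphere fun z hz => ?_
      simp only [mem_sphere_zero_iff_norm, abs_of_pos hr0] at hz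
      simp [mul_pow, hz]
    have h3 := mul_le_mul_of_nonneg_left (ih hD) (sq_nonneg r)
    rw [h1, h2, Finset.sum_range_succ', taylorCoeff_zero]
    simp only [taylorCoeff_dslope (hF.analyticAt hb), Finset.mul_sum] at h3
    have h4 : ∀ k, ‖taylorCoeff F (k + 1)‖ ^ 2 * r ^ (2 * (k + 1)) =
        r ^ 2 * (‖taylorCoeff F (k + 1)‖ ^ 2 * r ^ (2 * k)) := fun k => by ring
    simp only [h4, mul_zero, pow_zero, mul_one]
    linarith

/-- Littlewood's argument for polynomials in `w`: since `w(0) = 0`, the constant term is orthogonal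
to the rest, which has a factor `w` with `|w| ≤ r` on the circle; induct on the degree. -/
lemma circleAverage_normSq_comp_le {w : ℂ → ℂ} (hw : IsSchwarzFunction w) {r : ℝ} (hr0 : 0 < r)
    (hr1 : r < 1) (n : ℕ) : ∀ b : ℕ → ℂ,
      circleAverage (fun z => ‖∑ k ∈ Finset.range n, b k * w z ^ k‖ ^ 2) 0 r ≤
        ∑ k ∈ Finset.range n, ‖b k‖ ^ 2 * r ^ (2 * k) := by
  obtain ⟨hd, h0, hle⟩ := hw
  have hsub : sphere (0 : ℂ) r ⊆ ball 0 1 := fun z hz => by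
    simp only [mem_sphere_zero_iff_norm] at hz; simpa [hz] using hr1
  have hdQ : ∀ (b : ℕ → ℂ) (n : ℕ),
      DifferentiableOn ℂ (fun z => ∑ k ∈ Finset.range n, b k * w z ^ k) (ball 0 1) :=
    fun b n => by fun_prop
  induction n with
  | zero => intro b; simp [circleAverage_const]
  | succ n ih =>
    intro b
    have hQ := hdQ (fun k => b (k + 1)) n
    have h1 := circleAverage_normSq_const_add
      (G := fun z => w z * ∑ k ∈ Finset.range n, b (k + 1) * w z ^ k)
      (hd.fun_mul hQ) (by simp [h0]) (b 0) hr0 hr1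
    have h2 : ∀ z, b 0 + w z * ∑ k ∈ Finset.range n, b (k + 1) * w z ^ k =
        ∑ k ∈ Finset.range (n + 1), b k * w z ^ k := fun z => by
      rw [Finset.sum_range_succ', Finset.mul_sum, add_comm]
      simp only [pow_zero, mul_one]
      congr 1
      exact Finset.sum_congr rfl fun k _ => by ring
    simp only [h2] at h1
    have h3 : circleAverage (fun z => ‖w z * ∑ k ∈ Finset.range n, b (k + 1) * w z ^ k‖ ^ 2) 0 r ≤
        r ^ 2 * circleAverage (fun z => ‖∑ k ∈ Finset.range n, b (k + 1) * w z ^ k‖ ^ 2) 0 r := by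
      rw [← smul_eq_mul, ← circleAverage_fun_smul]
      have c1 := hQ.continuousOn.mono hsub
      have c2 := hd.continuousOn.mono hsub
      refine circleAverage_mono (ContinuousOn.circleIntegrable hr0.le ((c2.mul c1).norm.pow 2))
        (ContinuousOn.circleIntegrable hr0.le ((c1.norm.pow 2).const_smul (r ^ 2)))
        fun z hz => ?_
      rw [abs_of_pos hr0] at hz
      have hz' := hle z (hsub hz)
      rw [mem_sphere_zero_iff_norm.1 hz] at hz'
      rw [norm_mul, mul_pow, smul_eq_mul]
      gcongr
    have h4 := mul_le_mul_of_nonneg_left (ih fun k => b (k + 1)) (sq_nonneg r)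
    rw [h1, Finset.sum_range_succ']
    have h5 : ∀ k, ‖b (k + 1)‖ ^ 2 * r ^ (2 * (k + 1)) =
        r ^ 2 * (‖b (k + 1)‖ ^ 2 * r ^ (2 * k)) := fun k => by ring
    simp only [h5, mul_zero, pow_zero, mul_one, ← Finset.mul_sum]
    linarith

/-- **Rogosinski's inequality**: composition with a Schwarz function does not increase the
`ℓ²`-norm of an initial segment of the Taylor coefficients. -/
theorem sum_normSq_taylorCoeff_comp_le {h w : ℂ → ℂ} (hh : AnalyticAt ℂ h 0)
    (hw : IsSchwarzFunction w) (n : ℕ) :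
    ∑ k ∈ Finset.range n, ‖taylorCoeff (fun z => h (w z)) k‖ ^ 2 ≤
      ∑ k ∈ Finset.range n, ‖taylorCoeff h k‖ ^ 2 := by
  have hw' := hw
  obtain ⟨hd, h0, -⟩ := hw'
  have hb : ball (0 : ℂ) 1 ∈ 𝓝 0 := ball_mem_nhds _ one_pos
  have hwa : AnalyticAt ℂ w 0 := hd.analyticAt hb
  obtain ⟨g, hg, hgz⟩ := exists_taylor_remainder n hh
  set Q : ℂ → ℂ := fun z => ∑ k ∈ Finset.range n, taylorCoeff h k * w z ^ k with hQdef
  have hQ : DifferentiableOn ℂ Q (ball 0 1) := by fun_prop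
  have hgw : AnalyticAt ℂ (fun z => g (w z)) 0 := by
    refine AnalyticAt.fun_comp (f := w) ?_ hwa
    rwa [h0]
  have hT : taylorSeries (fun z => h (w z)) =
      taylorSeries Q + taylorSeries w ^ n * taylorSeries (fun z => g (w z)) := by
    rw [← taylorSeries_pow hwa, ← taylorSeries_mul (hwa.fun_pow n) hgw,
      ← taylorSeries_add (hQ.analyticAt hb) ((hwa.fun_pow n).fun_mul hgw)]
    exact congrArg taylorSeries (funext fun z => hgz (w z))
  -- As `w(0) = 0`, the remainder `wⁿ · (g ∘ w)` does not affect coefficients below `n`.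
  have hX : PowerSeries.X ^ n ∣
      taylorSeries w ^ n * taylorSeries (fun z => g (w z)) := by
    refine Dvd.dvd.mul_right (pow_dvd_pow_of_dvd ?_ n) _
    rw [PowerSeries.X_dvd_iff, ← PowerSeries.coeff_zero_eq_constantCoeff_apply,
      coeff_taylorSeries, taylorCoeff_zero, h0]
  have hcoeff : ∀ k ∈ Finset.range n, taylorCoeff (fun z => h (w z)) k = taylorCoeff Q k := by
    intro k hk
    have h1 := congrArg (PowerSeries.coeff k) hT
    rw [map_add, PowerSeries.X_pow_dvd_iff.1 hX k (Finset.mem_range.1 hk), add_zero] at h1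
    simpa using h1
  rw [Finset.sum_congr rfl fun k hk => by rw [hcoeff k hk]]
  have key : ∀ r ∈ Set.Ioo (0 : ℝ) 1,
      ∑ k ∈ Finset.range n, ‖taylorCoeff Q k‖ ^ 2 * r ^ (2 * k) ≤
        ∑ k ∈ Finset.range n, ‖taylorCoeff h k‖ ^ 2 * r ^ (2 * k) := fun r hr =>
    (sum_normSq_taylorCoeff_le_circleAverage hr.1 hr.2 n hQ).trans
      (circleAverage_normSq_comp_le hw hr.1 hr.2 n _)
  -- The weights `r^(2k)` disappear as `r → 1⁻`.
  have lim : ∀ b : ℕ → ℂ, Tendsto (fun r : ℝ => ∑ k ∈ Finset.range n, ‖b k‖ ^ 2 * r ^ (2 * k))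
      (𝓝[<] 1) (𝓝 (∑ k ∈ Finset.range n, ‖b k‖ ^ 2)) := fun b => by
    have : Continuous fun r : ℝ => ∑ k ∈ Finset.range n, ‖b k‖ ^ 2 * r ^ (2 * k) := by fun_prop
    simpa using (this.tendsto 1).mono_left nhdsWithin_le_nhds
  exact le_of_tendsto_of_tendsto (lim _) (lim _)
    (eventually_of_mem (Ioo_mem_nhdsLT one_pos) key)

end Littlewood

/-! ### Taylor coefficients of `√(1 + tanh z)`. -/

section Bean

open Filter Topology PowerSeries

lemma beanFunction_sq (z : ℂ) : beanFunction z ^ 2 = 1 + Complex.tanh z :=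
  Complex.cpow_nat_inv_pow _ two_ne_zero

lemma analyticAt_tanh_zero : AnalyticAt ℂ Complex.tanh 0 := by
  have : Complex.tanh = fun z => Complex.sinh z / Complex.cosh z :=
    funext Complex.tanh_eq_sinh_div_cosh
  rw [this]
  exact (Complex.differentiable_sinh.analyticAt 0).fun_div
    (Complex.differentiable_cosh.analyticAt 0) (by simp)

lemma analyticAt_beanFunction_zero : AnalyticAt ℂ beanFunction 0 :=
  (analyticAt_const.fun_add analyticAt_tanh_zero).cpow analyticAt_const (by simp)

lemma deriv_tanh_eventuallyEq :
    deriv Complex.tanh =ᶠ[𝓝 0] fun z => 1 + (-1) * Complex.tanh z ^ 2 := by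
  have h : ∀ᶠ z in 𝓝 (0 : ℂ), Complex.cosh z ≠ 0 :=
    Complex.continuous_cosh.continuousAt.eventually_ne (by simp)
  filter_upwards [h] with z hz
  have h1 := (Complex.hasDerivAt_sinh z).fun_div (Complex.hasDerivAt_cosh z) hz
  have : Complex.tanh = fun z => Complex.sinh z / Complex.cosh z :=
    funext Complex.tanh_eq_sinh_div_cosh
  rw [this, h1.deriv]
  field_simp
  ring

/-- The function `√(1 + tanh z)` satisfies `2 B' = 2 B - B ^ 3`. -/
lemma derivative_taylorSeries_beanFunction :
    2 * d⁄dX ℂ (taylorSeries beanFunction) =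
      2 * taylorSeries beanFunction - taylorSeries beanFunction ^ 3 := by
  have ha := analyticAt_tanh_zero
  set B := taylorSeries beanFunction with hB
  set T := taylorSeries Complex.tanh with hT
  have h1 : B ^ 2 = 1 + T := by
    rw [hB, ← taylorSeries_pow analyticAt_beanFunction_zero]
    simp only [beanFunction_sq]
    rw [taylorSeries_add analyticAt_const ha, taylorSeries_const, map_one]
  have h2 : d⁄dX ℂ T = 1 + (-1) * T ^ 2 := by
    rw [hT, ← taylorSeries_deriv, taylorSeries_congr deriv_tanh_eventuallyEq,
      taylorSeries_add analyticAt_const (analyticAt_const.fun_mul (ha.fun_pow 2)),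
      taylorSeries_mul analyticAt_const (ha.fun_pow 2), taylorSeries_pow ha]
    simp [taylorSeries_const]
  have h3 : 2 * B * d⁄dX ℂ B = d⁄dX ℂ T := by
    have := congrArg (d⁄dX ℂ) h1
    simpa [pow_two, Derivation.leibniz, two_mul, add_mul] using this
  -- With `T = B² - 1`, the equation `2BB' = 1 - T²` reads `2BB' = B(2B - B³)`; cancel `B`.
  have hB0 : B ≠ 0 := fun h => by
    have := congrArg (coeff 0) h
    simp [hB, taylorCoeff_zero, beanFunction] at this
  refine mul_left_cancel₀ hB0 ?_
  have h4 : T = B ^ 2 - 1 := by rw [h1]; ring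
  rw [h4] at h2
  linear_combination h3 + h2 + congrArg (d⁄dX ℂ) h4

lemma taylorCoeff_beanFunction_succ (n : ℕ) :
    taylorCoeff beanFunction (n + 1) = (taylorCoeff beanFunction n -
      coeff n (taylorSeries beanFunction ^ 3) / 2) / (n + 1) := by
  have h := congrArg (coeff n) derivative_taylorSeries_beanFunction
  have h2 : (2 : ℂ⟦X⟧) = C 2 := (map_ofNat C 2).symm
  rw [h2, map_sub, coeff_C_mul, coeff_C_mul, coeff_derivative] at h
  simp only [coeff_taylorSeries] at h
  have : (n : ℂ) + 1 ≠ 0 := by exact_mod_cast n.succ_ne_zero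
  rw [eq_div_iff this]
  linear_combination h / 2

lemma taylorCoeff_beanFunction :
    taylorCoeff beanFunction 0 = 1 ∧ taylorCoeff beanFunction 1 = 1 / 2 ∧
    taylorCoeff beanFunction 2 = -1 / 8 ∧ taylorCoeff beanFunction 3 = -5 / 48 ∧
    taylorCoeff beanFunction 4 = 17 / 384 ∧ taylorCoeff beanFunction 5 = 121 / 3840 ∧
    taylorCoeff beanFunction 6 = -721 / 46080 := by
  have h0 : taylorCoeff beanFunction 0 = 1 := by simp [taylorCoeff_zero, beanFunction]
  have h1 := taylorCoeff_beanFunction_succ 0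
  have h2 := taylorCoeff_beanFunction_succ 1
  have h3 := taylorCoeff_beanFunction_succ 2
  have h4 := taylorCoeff_beanFunction_succ 3
  have h5 := taylorCoeff_beanFunction_succ 4
  have h6 := taylorCoeff_beanFunction_succ 5
  have hc : ∀ n, coeff n (taylorSeries beanFunction ^ 3) =
      ∑ i ∈ Finset.range (n + 1), (∑ j ∈ Finset.range (i + 1),
        taylorCoeff beanFunction j * taylorCoeff beanFunction (i - j)) *
          taylorCoeff beanFunction (n - i) := fun n => by
    simp [pow_succ, coeff_mul, Finset.Nat.sum_antidiagonal_eq_sum_range_succ_mk]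
  simp only [hc, Finset.sum_range_succ, Finset.sum_range_zero, zero_add, Nat.sub_self,
    Nat.sub_zero, Nat.reduceAdd, Nat.reduceSub, h0] at h1 h2 h3 h4 h5 h6
  norm_num at h1
  rw [h1] at h2 h3 h4 h5 h6
  norm_num at h2
  rw [h2] at h3 h4 h5 h6
  norm_num at h3
  rw [h3] at h4 h5 h6
  norm_num at h4
  rw [h4] at h5 h6
  norm_num at h5
  rw [h5] at h6
  norm_num at h6
  refine ⟨h0, ?_, ?_, ?_, ?_, ?_, ?_⟩
  · rw [h1]
  · rw [h2]; norm_num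
  · rw [h3]; norm_num
  · rw [h4]
  · rw [h5]
  · rw [h6]; norm_num

/-- The 1 is the constant term, which cancels against `p₀ = 1`; the 3/10 rounds up the rest. -/
lemma sum_normSq_taylorCoeff_beanFunction_le :
    ∑ k ∈ Finset.range 7, ‖taylorCoeff beanFunction k‖ ^ 2 ≤ 1 + 3 / 10 := by
  obtain ⟨h0, h1, h2, h3, h4, h5, h6⟩ := taylorCoeff_beanFunction
  simp only [Finset.sum_range_succ, Finset.sum_range_zero, h0, h1, h2, h3, h4, h5, h6]
  norm_num

end Bean

/-! ### Bounds for the coefficients `a₂, …, a₇`. -/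

section Coefficients

open Filter Topology PowerSeries

/-- For `f` in the class, `z f' = f · p` with `p` having small Taylor coefficients. -/
lemma exists_multiplier_of_mem_starlikeBean {f : ℂ → ℂ} (hf : f ∈ StarlikeBean) :
    ∃ P : ℂ⟦X⟧, X * d⁄dX ℂ (taylorSeries f) = taylorSeries f * P ∧ coeff 0 P = 1 ∧
      ∑ k ∈ Finset.range 6, ‖coeff (k + 1) P‖ ^ 2 ≤ 3 / 10 := by
  obtain ⟨⟨hd, hf0, -⟩, hne, w, hw, hsub⟩ := hf
  have hb : ball (0 : ℂ) 1 ∈ 𝓝 0 := ball_mem_nhds _ one_pos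
  have hfa := hd.analyticAt hb
  have hwa := hw.1.analyticAt hb
  have hBw : AnalyticAt ℂ (fun z => beanFunction (w z)) 0 := by
    refine AnalyticAt.fun_comp (f := w) ?_ hwa
    rw [hw.2.1]
    exact analyticAt_beanFunction_zero
  have h0 : taylorCoeff (fun z => beanFunction (w z)) 0 = 1 := by
    simp [taylorCoeff_zero, hw.2.1, beanFunction]
  refine ⟨taylorSeries fun z => beanFunction (w z), ?_, by simpa using h0, ?_⟩
  · rw [← taylorSeries_deriv, ← taylorSeries_id,
      ← taylorSeries_mul (f := fun z => z) analyticAt_id hfa.deriv, ← taylorSeries_mul hfa hBw]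
    refine taylorSeries_congr ?_
    filter_upwards [hb] with z hz
    rcases eq_or_ne z 0 with rfl | hz0
    · simp [hf0]
    · rw [← hsub z hz, starlikeQuotient, Function.update_of_ne hz0]
      field_simp [hne z hz hz0]
  · have h := (sum_normSq_taylorCoeff_comp_le analyticAt_beanFunction_zero hw 7).trans
      sum_normSq_taylorCoeff_beanFunction_le
    rw [Finset.sum_range_succ', h0] at h
    simp only [coeff_taylorSeries]
    norm_num at h
    linarith

lemma normSq_taylorCoeff_le {f : ℂ → ℂ} (hf : f ∈ StarlikeBean) {n : ℕ} (hn : n < 6) :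
    ((n : ℝ) + 1) ^ 2 * ‖taylorCoeff f (n + 2)‖ ^ 2 ≤
      3 / 10 * ∑ k ∈ Finset.range (n + 1), ‖taylorCoeff f (k + 1)‖ ^ 2 := by
  obtain ⟨P, hP, hP0, hS⟩ := exists_multiplier_of_mem_starlikeBean hf
  have hf0 : taylorCoeff f 0 = 0 := by rw [taylorCoeff_zero, hf.1.2.1]
  have h1 : ((n : ℂ) + 1) * taylorCoeff f (n + 2) =
      ∑ k ∈ Finset.range (n + 1), taylorCoeff f (k + 1) * coeff (n - k + 1) P := by
    have h := congrArg (coeff (n + 2)) hP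
    rw [coeff_succ_X_mul, coeff_derivative, coeff_mul,
      Finset.Nat.sum_antidiagonal_eq_sum_range_succ_mk, Finset.sum_range_succ,
      Finset.sum_range_succ'] at h
    -- The bottom term vanishes since `a₀ = 0`; the top term `a_{n+2} p₀ = a_{n+2}` moves to the
    -- left, lowering the factor `n + 2` to `n + 1`.
    simp only [coeff_taylorSeries, hf0, zero_mul, add_zero, Nat.sub_self, hP0, mul_one] at h
    have h2 : ∀ k ∈ Finset.range (n + 1), taylorCoeff f (k + 1) * coeff (n + 2 - (k + 1)) P =
        taylorCoeff f (k + 1) * coeff (n - k + 1) P := fun k hk => by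
      congr 3
      have := Finset.mem_range.1 hk
      omega
    rw [Finset.sum_congr rfl h2] at h
    push_cast at h
    linear_combination h
  have h3 : ‖((n : ℂ) + 1) * taylorCoeff f (n + 2)‖ = ((n : ℝ) + 1) * ‖taylorCoeff f (n + 2)‖ := by
    rw [norm_mul]
    congr 1
    exact_mod_cast Complex.norm_natCast (n + 1)
  rw [← mul_pow, ← h3, h1]
  -- Reversed, this is the sum over `p₁, …, p_{n+1}`, part of the bounded sum because `n < 6`.
  have h4 : ∑ k ∈ Finset.range (n + 1), ‖coeff (n - k + 1) P‖ ^ 2 ≤ 3 / 10 := by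
    have h5 := Finset.sum_range_reflect (fun k => ‖coeff (k + 1) P‖ ^ 2) (n + 1)
    simp only [Nat.add_sub_cancel] at h5
    rw [h5]
    exact (Finset.sum_le_sum_of_subset_of_nonneg
      (Finset.range_subset_range.2 hn) fun _ _ _ => by positivity).trans hS
  calc ‖∑ k ∈ Finset.range (n + 1), taylorCoeff f (k + 1) * coeff (n - k + 1) P‖ ^ 2
      ≤ (∑ k ∈ Finset.range (n + 1), ‖taylorCoeff f (k + 1)‖ * ‖coeff (n - k + 1) P‖) ^ 2 := by
        gcongr
        exact (norm_sum_le _ _).trans_eq (by simp)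
    _ ≤ (∑ k ∈ Finset.range (n + 1), ‖taylorCoeff f (k + 1)‖ ^ 2) *
          ∑ k ∈ Finset.range (n + 1), ‖coeff (n - k + 1) P‖ ^ 2 := Finset.sum_mul_sq_le_sq_mul_sq _ _ _
    _ ≤ (∑ k ∈ Finset.range (n + 1), ‖taylorCoeff f (k + 1)‖ ^ 2) * (3 / 10) := by gcongr
    _ = _ := mul_comm _ _

/-- The constants are roundings up of the square roots produced by the recursion from `a₁ = 1`. -/
lemma norm_taylorCoeff_le {f : ℂ → ℂ} (hf : f ∈ StarlikeBean) :
    ‖taylorCoeff f 2‖ ≤ 11 / 20 ∧ ‖taylorCoeff f 3‖ ≤ 8 / 25 ∧ ‖taylorCoeff f 4‖ ≤ 11 / 50 ∧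
    ‖taylorCoeff f 5‖ ≤ 17 / 100 ∧ ‖taylorCoeff f 6‖ ≤ 7 / 50 ∧ ‖taylorCoeff f 7‖ ≤ 3 / 25 := by
  have h1 : taylorCoeff f 1 = 1 := by rw [taylorCoeff_one, hf.1.2.2]
  have e2 := normSq_taylorCoeff_le hf (n := 0) (by norm_num)
  have e3 := normSq_taylorCoeff_le hf (n := 1) (by norm_num)
  have e4 := normSq_taylorCoeff_le hf (n := 2) (by norm_num)
  have e5 := normSq_taylorCoeff_le hf (n := 3) (by norm_num)
  have e6 := normSq_taylorCoeff_le hf (n := 4) (by norm_num)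
  have e7 := normSq_taylorCoeff_le hf (n := 5) (by norm_num)
  norm_num [Finset.sum_range_succ, h1] at e2 e3 e4 e5 e6 e7
  refine ⟨?_, ?_, ?_, ?_, ?_, ?_⟩ <;>
    exact abs_le_of_sq_le_sq' (by linarith) (by norm_num) |>.2

end Coefficients

/-! ### Determinants bounded by permanents, and the conclusion. -/

section Determinant

lemma norm_det_fin_succ_le {n : ℕ} (A : Matrix (Fin (n + 1)) (Fin (n + 1)) ℂ) :
    ‖A.det‖ ≤ ∑ j, ‖A 0 j‖ * ‖(A.submatrix Fin.succ j.succAbove).det‖ := by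
  rw [Matrix.det_succ_row_zero]
  exact (norm_sum_le _ _).trans_eq (Finset.sum_congr rfl fun j _ => by simp)

/-- The determinant of a `3 × 3` matrix is at most the permanent of an entrywise majorant. -/
lemma norm_det_fin_three_le (A : Matrix (Fin 3) (Fin 3) ℂ) (M : Fin 3 → Fin 3 → ℝ)
    (h : ∀ i j, ‖A i j‖ ≤ M i j) :
    ‖A.det‖ ≤ M 0 0 * (M 1 1 * M 2 2 + M 1 2 * M 2 1) + M 0 1 * (M 1 0 * M 2 2 + M 1 2 * M 2 0) +
      M 0 2 * (M 1 0 * M 2 1 + M 1 1 * M 2 0) := by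
  have hM : ∀ i j, 0 ≤ M i j := fun i j => (norm_nonneg _).trans (h i j)
  have h2 : ∀ a b c d : Fin 3 × Fin 3,
      ‖A a.1 a.2 * A b.1 b.2 - A c.1 c.2 * A d.1 d.2‖ ≤
        M a.1 a.2 * M b.1 b.2 + M c.1 c.2 * M d.1 d.2 := fun a b c d => by
    refine (norm_sub_le _ _).trans ?_
    rw [norm_mul, norm_mul]
    gcongr <;> first | apply h | apply hM
  have e : A.det = A 0 0 * (A 1 1 * A 2 2 - A 1 2 * A 2 1) -
      A 0 1 * (A 1 0 * A 2 2 - A 1 2 * A 2 0) + A 0 2 * (A 1 0 * A 2 1 - A 1 1 * A 2 0) := by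
    rw [Matrix.det_fin_three]; ring
  rw [e]
  refine (norm_add_le _ _).trans (add_le_add ((norm_sub_le _ _).trans (add_le_add ?_ ?_)) ?_) <;>
    rw [norm_mul]
  · exact mul_le_mul (h 0 0) (h2 (1, 1) (2, 2) (1, 2) (2, 1)) (norm_nonneg _) (hM 0 0)
  · exact mul_le_mul (h 0 1) (h2 (1, 0) (2, 2) (1, 2) (2, 0)) (norm_nonneg _) (hM 0 1)
  · exact mul_le_mul (h 0 2) (h2 (1, 0) (2, 1) (1, 1) (2, 0)) (norm_nonneg _) (hM 0 2)

end Determinant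

theorem mainTheorem6 (f : ℂ → ℂ) (hf : f ∈ StarlikeBean) :
    ‖hankelDet f 4 1‖ ≤ 0.169251 := by
  have h1 : ‖taylorCoeff f 1‖ ≤ 1 := by rw [taylorCoeff_one, hf.1.2.2, norm_one]
  obtain ⟨h2, h3, h4, h5, h6, h7⟩ := norm_taylorCoeff_le hf
  -- Majorants of `|a₁|, …, |a₇|`; entry 0 and the default are placeholders, as `1 + i + j` runs
  -- over 1 to 7.
  let m : ℕ → ℝ := fun n => [0, 1, 11 / 20, 8 / 25, 11 / 50, 17 / 100, 7 / 50, 3 / 25].getD n 0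
  have hm : ∀ i j : Fin 4, ‖taylorCoeff f (1 + (i : ℕ) + (j : ℕ))‖ ≤ m (1 + i + j) := by
    intro i j
    fin_cases i <;> fin_cases j <;> assumption
  refine (norm_det_fin_succ_le _).trans ?_
  have key : ∀ j : Fin 4, _ := fun j => mul_le_mul (hm 0 j)
    (norm_det_fin_three_le _ (fun p q => m (1 + (p.succ : Fin 4) + (j.succAbove q : Fin 4)))
      fun p q => hm p.succ (j.succAbove q)) (norm_nonneg _) ((norm_nonneg _).trans (hm 0 j))
  refine (Finset.sum_le_sum fun j _ => key j).trans ?_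
  -- What remains is the numerical permanent, about 0.102.
  simp [Fin.sum_univ_four, m, Fin.succAbove]
  norm_num
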